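/- A permutation of $[n]=\{1,\dots,n\}$ is written as the sequence $(\pi(1),\dots,\pi(n))$. The shape of a sequence $(x_1,\dots,x_w)$ of distinct numbers is the sequence $(s_1,\dots,s_{w-1})\in\{+,-\}^{w-1}$ with $s_i=+$ if and only if $x_i<x_{i+1}$. Weak twins of length $w$ in $\pi$ are two sub-permutations $(\pi(i_1),\dots,\pi(i_w))$, $i_1<\dots<i_w$, and $(\pi(j_1),\dots,\pi(j_w))$, $j_1<\dots<j_w$, with $\{i_1,\dots,i_w\}\cap\{j_1,\dots,j_w\}=\emptyset$ and with the same shape; they are alternating twins if this common shape is $(+,-,+,\dots)$ or $(-,+,-,\dots)$. Let $\alpha(\pi)$ be the largest $w$ such that $\pi$ contains alternating twins of length $w$, and let $\alpha_n=\alpha(\Pi_n)$, where $\Pi_n$ is chosen uniformly at random from all $n!$ permutations of $[n]$. Theorem. Asymptotically almost surely, $$\left(\frac13+\frac1{60}+o(1)\right)n\le\alpha_n\le\left(\frac12-\frac1{120}+o(1)\right)n,$$ that is, there are deterministic sequences $\varepsilon_n\to0$ and $\delta_n\to0$ such that $$\lim_{n\to\infty}\mathbb P\left(\left(\frac13+\frac1{60}+\varepsilon_n\right)n\le\alpha_n\le\left(\frac12-\frac1{120}+\delta_n\right)n\right)=1.$$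 -/

import Mathlib

namespace Twins

/-- The shape of a sequence `x₁, …, x_w` with distinct entries: entry `k` is `true` (a `+`) if the
`k`-th entry is smaller than the next one and `false` (a `-`) otherwise (indices start at `0`). -/
def shape {n w : ℕ} (x : Fin w → Fin n) : Fin (w - 1) → Bool :=
  fun k => decide (x ⟨k, by omega⟩ < x ⟨k + 1, by omega⟩)

/-- The alternating shape `(+, -, +, …)` of a sequence of length `w`. -/
def altPlus (w : ℕ) : Fin (w - 1) → Bool := fun k => decide (Even (k : ℕ))

/-- The alternating shape `(-, +, -, …)` of a sequence of length `w`. -/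
def altMinus (w : ℕ) : Fin (w - 1) → Bool := fun k => decide (Odd (k : ℕ))

/-- The sub-permutations of `π` at the increasing position sequences `i` and `j` are weak twins:
they are disjoint and have the same shape. -/
def IsWeakTwins {n w : ℕ} (π : Equiv.Perm (Fin n)) (i j : Fin w ↪o Fin n) : Prop :=
  Disjoint (Set.range i) (Set.range j) ∧ shape (π ∘ i) = shape (π ∘ j)

/-- `π` contains alternating twins of length `w`. -/
def HasAlternatingTwins {n : ℕ} (π : Equiv.Perm (Fin n)) (w : ℕ) : Prop :=
  ∃ i j : Fin w ↪o Fin n, IsWeakTwins π i j ∧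
    (shape (π ∘ i) = altPlus w ∨ shape (π ∘ i) = altMinus w)

/-- The largest length of alternating twins in `π`. -/
noncomputable def alpha {n : ℕ} (π : Equiv.Perm (Fin n)) : ℕ :=
  sSup {w | HasAlternatingTwins π w}

/-- The supremum in the definition of `alpha` is a maximum. -/
theorem isGreatest_alpha {n : ℕ} (π : Equiv.Perm (Fin n)) :
    IsGreatest {w | HasAlternatingTwins π w} (alpha π) := by
  have hb : BddAbove {w | HasAlternatingTwins π w} := by
    refine ⟨n, ?_⟩
    rintro w ⟨i, -, -⟩
    simpa using Fintype.card_le_of_injective i i.injective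
  have hne : {w | HasAlternatingTwins π w}.Nonempty := by
    refine ⟨0, OrderEmbedding.ofIsEmpty, OrderEmbedding.ofIsEmpty, ⟨?_, rfl⟩, Or.inl ?_⟩
    · simp
    · funext k
      exact k.elim0
  exact ⟨Nat.sSup_mem hne hb, fun w hw => le_csSup hb hw⟩

end Twins

/-!
Fix the turns (interior local extrema) of the sequence `π(1), …, π(n)`.

Upper bound. An alternating subsequence has at most `t + 2` terms in an interval `[x, y]` with `t`
turns strictly inside, as `π` must change direction between any two consecutive steps of it. If `x`
is a turn at distance at most three from the previous one, while there are no such turns between `x`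
and `y`, then the at most `2 t + 4 ≤ 3 (t + 1) + 1` terms of two disjoint alternating subsequences
can be charged to `x` and to the three positions following each of the `t + 1` turns. Hence
alternating twins of length `w` satisfy `2 w ≤ n + 1 - M`, where `M` is the number of monotone
windows of length five, since the last position of such a window is never charged. A window of
length five is monotone with probability `2 / 5! = 1 / 60`.

Lower bound. Twins are found in two disjoint sets of positions: the turns in the first half together
with the non-turns in the second half, and vice versa. The subsequence of the turns alternates, and
a position is a turn with probability `2 / 3`. The subsequence of the non-turns still turns where
two adjacent non-turns are followed by a turn and then by a non-turn, or the mirror image of this,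
provided that the direction changes; this has probability `1 / 30`. Both subsequences thus turn
about `(2 / 3 + 1 / 30) n / 2 = (1 / 3 + 1 / 60) n` times.

The numbers of windows concentrate by Chebyshev's inequality, as the patterns in two disjoint
windows are uncorrelated: permuting the entries of one window at random does not affect the other.
-/

namespace Twins

theorem card_filter_lt_eq_add {ι : Type*} [LinearOrder ι] (S : Finset ι) {x y : ι} (hxy : x ≤ y) :
    (S.filter (· < y)).card = (S.filter (· < x)).card + (S.filter fun z => x ≤ z ∧ z < y).card := by
  rw [← Finset.card_filter_add_card_filter_not (s := S.filter (· < y)) (· < x),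
    Finset.filter_filter, Finset.filter_filter]
  congr 2 <;> ext z <;> simp only [Finset.mem_filter, not_lt]
  · exact ⟨fun h => ⟨h.1, h.2.2⟩, fun h => ⟨h.1, h.2.trans_le hxy, h.2⟩⟩
  · tauto

theorem card_filter_add_card_filter_le {ι : Type*} [LinearOrder ι] (T : Finset ι) (x y z : ι) :
    (T.filter fun e => x ≤ e ∧ e < y).card + (T.filter fun e => y ≤ e ∧ e < z).card ≤ T.card := by
  rw [← Finset.card_union_of_disjoint
    (Finset.disjoint_filter.2 fun e _ he he' => he.2.not_ge he'.1)]
  exact Finset.card_le_card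
    (Finset.union_subset (Finset.filter_subset _ _) (Finset.filter_subset _ _))

section Turns

variable {ι α : Type*} [LinearOrder ι] [LinearOrder α] {f : ι → α} {S T : Finset ι}
  {a b c p q p' q' x y : ι}

/-- `a` and `b` are neighbouring elements of `S`, with `a` to the left of `b`. -/
structure Consecutive (S : Finset ι) (a b : ι) : Prop where
  left_mem : a ∈ S
  right_mem : b ∈ S
  lt : a < b
  right_le : ∀ x ∈ S, a < x → b ≤ x

theorem Consecutive.le_left (h : Consecutive S a b) (hx : x ∈ S) (hxb : x < b) : x ≤ a :=
  le_of_not_gt fun hax => (h.right_le x hx hax).not_gt hxb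

theorem Consecutive.right_unique (h : Consecutive S a b) (h' : Consecutive S a c) : b = c :=
  le_antisymm (h.right_le c h'.right_mem h'.lt) (h'.right_le b h.right_mem h.lt)

theorem Consecutive.congr (h : Consecutive S a b) (hST : ∀ x, a ≤ x → x ≤ b → (x ∈ S ↔ x ∈ T)) :
    Consecutive T a b where
  left_mem := (hST a le_rfl h.lt.le).1 h.left_mem
  right_mem := (hST b h.lt.le le_rfl).1 h.right_mem
  lt := h.lt
  right_le x hx hax := le_of_not_gt fun hxb =>
    (h.right_le x ((hST x hax.le hxb.le).2 hx) hax).not_gt hxb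

theorem exists_consecutive_right (ha : a ∈ S) (hb : b ∈ S) (hab : a < b) :
    ∃ c, c ≤ b ∧ Consecutive S a c := by
  have hne : (S.filter (a < ·)).Nonempty := ⟨b, by simp [hb, hab]⟩
  obtain ⟨hcS, hac⟩ := Finset.mem_filter.1 (Finset.min'_mem _ hne)
  exact ⟨_, Finset.min'_le _ _ (by simp [hb, hab]), ha, hcS, hac,
    fun x hx hax => Finset.min'_le _ _ (by simp [hx, hax])⟩

theorem exists_consecutive_left (ha : a ∈ S) (hb : b ∈ S) (hab : a < b) :
    ∃ c, a ≤ c ∧ Consecutive S c b := by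
  have hne : (S.filter (· < b)).Nonempty := ⟨a, by simp [ha, hab]⟩
  obtain ⟨hcS, hcb⟩ := Finset.mem_filter.1 (Finset.max'_mem _ hne)
  exact ⟨_, Finset.le_max' _ _ (by simp [ha, hab]), hcS, hb, hcb, fun x hx hcx =>
    le_of_not_gt fun hxb => (Finset.le_max' _ x (by simp [hx, hxb])).not_gt hcx⟩

/-- The restriction of `f` to `S` changes direction at `b`. When `f` is injective on `S` this says
that `b` is a local extremum of the restriction, not at either end. -/
def IsTurn (f : ι → α) (S : Finset ι) (b : ι) : Prop :=
  ∃ a c, Consecutive S a b ∧ Consecutive S b c ∧ ¬(f a < f b ↔ f b < f c)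

open Classical in
/-- The set of turns of the restriction of `f` to `S`. -/
noncomputable def turns (f : ι → α) (S : Finset ι) : Finset ι := S.filter (IsTurn f S)

theorem mem_turns : b ∈ turns f S ↔ IsTurn f S b := by
  simp only [turns, Finset.mem_filter, and_iff_right_iff_imp]
  rintro ⟨a, c, hab, -⟩
  exact hab.right_mem

theorem turns_subset (f : ι → α) (S : Finset ι) : turns f S ⊆ S := by
  classical exact Finset.filter_subset _ _

theorem exists_consecutive_lt_iff (ha : a ∈ S) (hb : b ∈ S) (hab : a < b) :
    ∃ p q, Consecutive S p q ∧ a ≤ p ∧ q ≤ b ∧ (f p < f q ↔ f a < f b) := by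
  set F := S.filter fun x => a ≤ x ∧ x < b ∧ (f x < f b ↔ f a < f b) with hF
  have hne : F.Nonempty := ⟨a, by simp [hF, ha, hab]⟩
  obtain ⟨hpS, hap, hpb, hp⟩ := Finset.mem_filter.1 (F.max'_mem hne)
  obtain ⟨q, hqb, hpq⟩ := exists_consecutive_right hpS hb hpb
  refine ⟨_, q, hpq, hap, hqb, ?_⟩
  rcases hqb.eq_or_lt with rfl | hqb
  · exact hp
  have hq : ¬(f q < f b ↔ f a < f b) := fun hq =>
    (F.le_max' q (by simp [hF, hpq.right_mem, hqb, hq, hap.trans hpq.lt.le])).not_gt hpq.lt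
  by_cases hd : f a < f b
  · simp only [hd, iff_true, not_lt] at hp hq ⊢
    exact hp.trans_le hq
  · simp only [hd, iff_false, not_lt, not_le] at hp hq ⊢
    exact hq.le.trans hp

theorem exists_isTurn_of_not_iff (hpq : Consecutive S p q) (hpq' : Consecutive S p' q')
    (hqp : q ≤ p') (hne : ¬(f p < f q ↔ f p' < f q')) :
    ∃ e, q ≤ e ∧ e ≤ p' ∧ IsTurn f S e := by
  classical
  set F := S.filter fun x => x ≤ p' ∧ ∃ y, Consecutive S y x ∧ (f y < f x ↔ f p < f q)
  have hqF : q ∈ F := Finset.mem_filter.2 ⟨hpq.right_mem, hqp, p, hpq, Iff.rfl⟩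
  obtain ⟨heS, hep, y, hye, hy⟩ := Finset.mem_filter.1 (F.max'_mem ⟨q, hqF⟩)
  refine ⟨_, F.le_max' q hqF, hep, ?_⟩
  rcases hep.eq_or_lt with he | hep
  · exact ⟨y, q', hye, he ▸ hpq', by rwa [hy, he]⟩
  obtain ⟨z, hzp, hez⟩ := exists_consecutive_right heS hpq'.left_mem hep
  refine ⟨y, z, hye, hez, fun h => (F.le_max' z ?_).not_gt hez.lt⟩
  exact Finset.mem_filter.2 ⟨hez.right_mem, hzp, _, hez, h.symm.trans hy⟩

theorem Consecutive.lt_iff_of_forall_not_isTurn (hpq : Consecutive S p q) (ha : a ∈ S) (hb : b ∈ S)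
    (hap : a ≤ p) (hqb : q ≤ b) (h : ∀ e, a < e → e < b → ¬IsTurn f S e) :
    f p < f q ↔ f a < f b := by
  obtain ⟨p', q', hpq', hap', hqb', hd⟩ :=
    exists_consecutive_lt_iff (f := f) ha hb (hap.trans_lt (hpq.lt.trans_le hqb))
  rw [← hd]
  by_contra hne
  rcases lt_trichotomy p p' with hlt | rfl | hlt
  · obtain ⟨e, hqe, hep, he⟩ :=
      exists_isTurn_of_not_iff hpq hpq' (hpq.right_le _ hpq'.left_mem hlt) hne
    exact h e (hap.trans_lt (hpq.lt.trans_le hqe)) (hep.trans_lt (hpq'.lt.trans_le hqb')) he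
  · exact hne (by rw [hpq.right_unique hpq'])
  · obtain ⟨e, hqe, hep, he⟩ :=
      exists_isTurn_of_not_iff hpq' hpq (hpq'.right_le _ hpq.left_mem hlt) fun h => hne h.symm
    exact h e (hap'.trans_lt (hpq'.lt.trans_le hqe)) (hep.trans_lt (hpq.lt.trans_le hqb)) he

theorem Consecutive.not_lt_iff_lt_of_turns (hab : Consecutive (turns f S) a b)
    (hbc : Consecutive (turns f S) b c) : ¬(f a < f b ↔ f b < f c) := by
  have ha := turns_subset f S hab.left_mem
  have hb := turns_subset f S hab.right_mem
  have hc := turns_subset f S hbc.right_mem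
  obtain ⟨p, q, hpb, hbq, hne⟩ := mem_turns.1 hab.right_mem
  have hdir_left : f p < f b ↔ f a < f b :=
    hpb.lt_iff_of_forall_not_isTurn ha hb (hpb.le_left ha hab.lt) le_rfl fun e hae heb he =>
      (hab.right_le e (mem_turns.2 he) hae).not_gt heb
  have hdir_right : f b < f q ↔ f b < f c :=
    hbq.lt_iff_of_forall_not_isTurn hb hc le_rfl (hbq.right_le c hc hbc.lt) fun e hbe hec he =>
      (hbc.right_le e (mem_turns.2 he) hbe).not_gt hec
  rwa [hdir_left, hdir_right] at hne

theorem card_turns_filter_le (hagree : ∀ z, x ≤ z → z < y → (z ∈ T ↔ z ∈ turns f S)) :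
    ((turns f S).filter fun z => x ≤ z ∧ z < y).card ≤
      ((turns f T).filter fun z => x ≤ z ∧ z < y).card + 2 := by
  set E := (turns f S).filter fun z => x ≤ z ∧ z < y
  rcases E.eq_empty_or_nonempty with hempty | hne
  · simp [hempty]
  obtain ⟨hmin, hxmin, -⟩ := Finset.mem_filter.1 (E.min'_mem hne)
  obtain ⟨hmax, -, hmaxy⟩ := Finset.mem_filter.1 (E.max'_mem hne)
  suffices hsub : E ⊆ (turns f T).filter (fun z => x ≤ z ∧ z < y) ∪ {E.min' hne, E.max' hne} from
    (Finset.card_le_card hsub).trans ((Finset.card_union_le _ _).trans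
      (Nat.add_le_add_left Finset.card_le_two _))
  intro b hb
  obtain ⟨hbE, hxb, hby⟩ := Finset.mem_filter.1 hb
  by_cases hbmin : b = E.min' hne
  · simp [hbmin]
  by_cases hbmax : b = E.max' hne
  · simp [hbmax]
  obtain ⟨a, hmina, hab⟩ :=
    exists_consecutive_left hmin hbE (lt_of_le_of_ne (E.min'_le b hb) (Ne.symm hbmin))
  obtain ⟨c, hcmax, hbc⟩ :=
    exists_consecutive_right hbE hmax (lt_of_le_of_ne (E.le_max' b hb) hbmax)
  have hturn : IsTurn f T b :=
    ⟨a, c, hab.congr fun z haz hzb => (hagree z (hxmin.trans (hmina.trans haz))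
        (hzb.trans_lt hby)).symm,
      hbc.congr fun z hbz hzc => (hagree z (hxb.trans hbz) (hzc.trans_lt
        (hcmax.trans_lt hmaxy))).symm, hab.not_lt_iff_lt_of_turns hbc⟩
  exact Finset.mem_union_left _ (Finset.mem_filter.2 ⟨mem_turns.2 hturn, hxb, hby⟩)

/-- The sequence `x` changes direction at its entry `i + 1`. -/
def TurnsAt (x : ℕ → α) (i : ℕ) : Prop := ¬(x i < x (i + 1) ↔ x (i + 1) < x (i + 2))

/-- The first `w` terms of `x` go alternately up and down, in either order. -/
def IsAlternating (x : ℕ → α) (w : ℕ) : Prop := ∀ k, k + 2 < w → TurnsAt x k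

theorem IsAlternating.lt_iff_even {x : ℕ → α} {w k : ℕ} (hx : IsAlternating x w) (hk : k + 1 < w) :
    x k < x (k + 1) ↔ (Even k ↔ x 0 < x 1) := by
  induction k with
  | zero => simp
  | succ k ih =>
    have hstep : ¬(x k < x (k + 1) ↔ x (k + 1) < x (k + 2)) := hx k hk
    have hk_iff := ih (by omega)
    rw [Nat.even_add_one]
    tauto

section Subsequence

variable {u : ℕ → ι} {w : ℕ}

/-- `u 0 < u 1 < ⋯ < u (w - 1)` are elements of `S` along which `f` goes alternately up and
down. -/
structure IsAlternatingAlong (f : ι → α) (S : Finset ι) (u : ℕ → ι) (w : ℕ) : Prop where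
  strictMonoOn : StrictMonoOn u (Set.Iio w)
  mem : ∀ k < w, u k ∈ S
  isAlternating : IsAlternating (f ∘ u) w

theorem IsAlternatingAlong.lt (hu : IsAlternatingAlong f S u w) {k l : ℕ} (hkl : k < l)
    (hl : l < w) : u k < u l :=
  hu.strictMonoOn (hkl.trans hl) hl hkl

theorem IsAlternatingAlong.card_image (hu : IsAlternatingAlong f S u w) :
    ((Finset.range w).image u).card = w := by
  rw [Finset.card_image_of_injOn, Finset.card_range]
  simpa using hu.strictMonoOn.injOn

theorem IsAlternatingAlong.le_card_turns_of_consecutive (hu : IsAlternatingAlong f S u w)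
    {k l : ℕ} (hkl : k ≤ l) (hl : l + 1 < w) (hpq : Consecutive S p q) (hp : u l ≤ p)
    (hq : q ≤ u (l + 1)) (hd : f p < f q ↔ f (u l) < f (u (l + 1))) :
    l ≤ k + ((turns f S).filter fun z => u k < z ∧ z ≤ p).card := by
  induction l, hkl using Nat.le_induction generalizing p q with
  | base => exact Nat.le_add_right _ _
  | succ l hkl ih =>
    obtain ⟨p', q', hpq', hp', hq', hd'⟩ := exists_consecutive_lt_iff (f := f)
      (hu.mem l (by omega)) (hu.mem (l + 1) (by omega)) (hu.lt l.lt_succ_self (by omega))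
    obtain ⟨e, hqe, hep, he⟩ := exists_isTurn_of_not_iff hpq' hpq (hq'.trans hp)
      (by rw [hd, hd']; exact hu.isAlternating l hl)
    have hle := ih (by omega) hpq' hp' hq' hd'
    have hkp' : u k ≤ p' :=
      (hkl.eq_or_lt.elim (fun h => h ▸ le_rfl) fun h => (hu.lt h (by omega)).le).trans hp'
    have hssub : (turns f S).filter (fun z => u k < z ∧ z ≤ p') ⊂
        (turns f S).filter fun z => u k < z ∧ z ≤ p := by
      refine Finset.ssubset_iff_of_subset (fun z hz => ?_) |>.2 ⟨e, ?_, ?_⟩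
      · simp only [Finset.mem_filter] at hz ⊢
        exact ⟨hz.1, hz.2.1, hz.2.2.trans (hpq'.lt.le.trans (hqe.trans hep))⟩
      · simp only [Finset.mem_filter]
        exact ⟨mem_turns.2 he, hkp'.trans_lt (hpq'.lt.trans_le hqe), hep⟩
      · simp only [Finset.mem_filter, not_and, not_le]
        exact fun _ _ => hpq'.lt.trans_le hqe
    have := Finset.card_lt_card hssub
    omega

theorem IsAlternatingAlong.le_card_turns (hu : IsAlternatingAlong f S u w) {k l : ℕ} (hkl : k ≤ l)
    (hl : l < w) : l ≤ k + 1 + ((turns f S).filter fun z => u k < z ∧ z < u l).card := by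
  rcases hkl.eq_or_lt with rfl | hkl
  · omega
  obtain ⟨l, rfl⟩ : ∃ m, l = m + 1 := ⟨l - 1, by omega⟩
  obtain ⟨p, q, hpq, hp, hq, hd⟩ := exists_consecutive_lt_iff (f := f)
    (hu.mem l (by omega)) (hu.mem (l + 1) hl) (hu.lt l.lt_succ_self hl)
  have hle := hu.le_card_turns_of_consecutive (Nat.le_of_lt_succ hkl) hl hpq hp hq hd
  have hmono := Finset.card_le_card <| Finset.monotone_filter_right (turns f S)
    fun z _ (hz : u k < z ∧ z ≤ p) =>
      (⟨hz.1, hz.2.trans_lt (hpq.lt.trans_le hq)⟩ : u k < z ∧ z < u (l + 1))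
  omega

theorem IsAlternatingAlong.card_image_filter_le (hu : IsAlternatingAlong f S u w) (x y : ι) :
    (((Finset.range w).image u).filter fun z => x ≤ z ∧ z ≤ y).card ≤
      ((turns f S).filter fun z => x < z ∧ z < y).card + 2 := by
  set K := (Finset.range w).filter fun k => x ≤ u k ∧ u k ≤ y
  rw [Finset.filter_image]
  refine Finset.card_image_le.trans ?_
  change K.card ≤ _
  rcases K.eq_empty_or_nonempty with hempty | hne
  · simp [hempty]
  obtain ⟨-, hxmin, -⟩ := Finset.mem_filter.1 (K.min'_mem hne)
  obtain ⟨hmax, -, hmaxy⟩ := Finset.mem_filter.1 (K.max'_mem hne)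
  have hcard : K.card ≤ K.max' hne + 1 - K.min' hne := by
    rw [← Nat.card_Icc]
    exact Finset.card_le_card fun k hk => Finset.mem_Icc.2 ⟨K.min'_le k hk, K.le_max' k hk⟩
  have hturns := hu.le_card_turns (K.min'_le_max' hne) (Finset.mem_range.1 hmax)
  have hmono := Finset.card_le_card <| Finset.monotone_filter_right (turns f S)
    fun z _ (hz : u (K.min' hne) < z ∧ z < u (K.max' hne)) =>
      (⟨hxmin.trans_lt hz.1, hz.2.trans_le hmaxy⟩ : x < z ∧ z < y)
  omega

theorem IsAlternatingAlong.card_union_filter_le {u' : ℕ → ι} {w' : ℕ}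
    (hu : IsAlternatingAlong f S u w) (hu' : IsAlternatingAlong f S u' w')
    (hT : turns f S ⊆ T) (hx : x ∈ T) (hxy : x < y) :
    (((Finset.range w).image u ∪ (Finset.range w').image u').filter fun z => x ≤ z ∧ z ≤ y).card ≤
      2 * (T.filter fun z => x ≤ z ∧ z < y).card + 2 := by
  have hcard := hu.card_image_filter_le x y
  have hcard' := hu'.card_image_filter_le x y
  have hssub : ((turns f S).filter fun z => x < z ∧ z < y) ⊂ T.filter fun z => x ≤ z ∧ z < y := by
    refine (Finset.ssubset_iff_of_subset fun z hz => ?_).2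
      ⟨x, Finset.mem_filter.2 ⟨hx, le_rfl, hxy⟩, by simp⟩
    obtain ⟨hzf, hxz, hzy⟩ := Finset.mem_filter.1 hz
    exact Finset.mem_filter.2 ⟨hT hzf, hxz.le, hzy⟩
  have hlt := Finset.card_lt_card hssub
  rw [Finset.filter_union]
  refine (Finset.card_union_le _ _).trans ?_
  omega

end Subsequence

end Turns

section Range

variable {α : Type*} [LinearOrder α] {g : ℕ → α} {n a b i : ℕ}

theorem consecutive_range : Consecutive (Finset.range n) a b ↔ b = a + 1 ∧ b < n := by
  refine ⟨fun h => ?_, ?_⟩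
  · have hb := Finset.mem_range.1 h.right_mem
    have := h.right_le (a + 1) (Finset.mem_range.2 (hb.trans_le' h.lt)) a.lt_succ_self
    exact ⟨le_antisymm this h.lt, hb⟩
  · rintro ⟨rfl, hb⟩
    exact ⟨Finset.mem_range.2 (by omega), Finset.mem_range.2 hb, a.lt_succ_self,
      fun x _ hx => hx⟩

theorem isTurn_range_succ :
    IsTurn g (Finset.range n) (i + 1) ↔ i + 2 < n ∧ TurnsAt g i := by
  constructor
  · rintro ⟨a, c, hab, hbc, hne⟩
    obtain ⟨hai, -⟩ := consecutive_range.1 hab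
    obtain ⟨rfl, hc⟩ := consecutive_range.1 hbc
    obtain rfl : i = a := Nat.succ_injective hai
    exact ⟨hc, hne⟩
  · rintro ⟨hi, hne⟩
    exact ⟨i, i + 2, consecutive_range.2 ⟨rfl, by omega⟩, consecutive_range.2 ⟨rfl, hi⟩, hne⟩

end Range

section Patterns

/-- The patterns of length `k` are the predicates on sequences which only depend on the relative
order of the first `k` entries. -/
def DependsOnOrder (k : ℕ) (Q : (ℕ → ℕ) → Prop) : Prop :=
  ∀ x y : ℕ → ℕ, (∀ i < k, ∀ j < k, x i < x j ↔ y i < y j) → (Q x ↔ Q y)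

/-- The number of positions `i` such that the window `[i, i + k)` is contained in `[x, y)` and the
sequence `g` has the pattern `Q` in this window. -/
def patternCount (k : ℕ) (Q : (ℕ → ℕ) → Prop) [DecidablePred Q] (g : ℕ → ℕ) (x y : ℕ) : ℕ :=
  ((Finset.Ico x (y + 1 - k)).filter fun i => Q fun j => g (i + j)).card

instance (x : ℕ → ℕ) (i : ℕ) : Decidable (TurnsAt x i) := inferInstanceAs (Decidable (¬_))

/-- The pattern of length `3` with a turn in the middle. -/
def TurnPattern (x : ℕ → ℕ) : Prop := TurnsAt x 0

instance : DecidablePred TurnPattern := fun x => inferInstanceAs (Decidable (TurnsAt x 0))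

/-- The pattern of length `5` without turns: the first five entries are monotone. -/
def MonotonePattern (x : ℕ → ℕ) : Prop := ∀ i < 3, ¬TurnsAt x i

instance : DecidablePred MonotonePattern := fun x =>
  inferInstanceAs (Decidable (∀ i < 3, ¬TurnsAt x i))

/-- The pattern of length `6` which makes entry `2` a turn of the subsequence of the non-turns: the
entries `1`, `2`, `4` are consecutive non-turns, and the steps between them differ in direction. -/
def EarlyTurnPattern (x : ℕ → ℕ) : Prop :=
  ¬TurnsAt x 0 ∧ ¬TurnsAt x 1 ∧ TurnsAt x 2 ∧ ¬TurnsAt x 3 ∧ ¬(x 1 < x 2 ↔ x 2 < x 4)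

/-- The pattern of length `6` which makes entry `3` a turn of the subsequence of the non-turns: the
entries `1`, `3`, `4` are consecutive non-turns, and the steps between them differ in direction. -/
def LateTurnPattern (x : ℕ → ℕ) : Prop :=
  ¬TurnsAt x 0 ∧ TurnsAt x 1 ∧ ¬TurnsAt x 2 ∧ ¬TurnsAt x 3 ∧ ¬(x 1 < x 3 ↔ x 3 < x 4)

/-- The pattern of length `6` which produces a turn of the subsequence of the non-turns. -/
def InteriorTurnPattern (x : ℕ → ℕ) : Prop := EarlyTurnPattern x ∨ LateTurnPattern x

instance : DecidablePred EarlyTurnPattern := fun _ => inferInstanceAs (Decidable (_ ∧ _))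

instance : DecidablePred LateTurnPattern := fun _ => inferInstanceAs (Decidable (_ ∧ _))

instance : DecidablePred InteriorTurnPattern := fun _ => inferInstanceAs (Decidable (_ ∨ _))

theorem dependsOnOrder_turnPattern : DependsOnOrder 3 TurnPattern := fun x y h => by
  simp [TurnPattern, TurnsAt, h]

theorem dependsOnOrder_monotonePattern : DependsOnOrder 5 MonotonePattern := fun x y h =>
  forall₂_congr fun i hi => by
    simp only [TurnsAt, h i (by omega) (i + 1) (by omega), h (i + 1) (by omega) (i + 2) (by omega)]

theorem dependsOnOrder_interiorTurnPattern : DependsOnOrder 6 InteriorTurnPattern :=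
  fun x y h => by
    simp [InteriorTurnPattern, EarlyTurnPattern, LateTurnPattern, TurnsAt, h]

/-- The sequence `π(0), …, π(n - 1)`, continued by zeros. -/
def value {n : ℕ} (π : Equiv.Perm (Fin n)) (i : ℕ) : ℕ := if h : i < n then π ⟨i, h⟩ else 0

theorem value_of_lt {n i : ℕ} (π : Equiv.Perm (Fin n)) (h : i < n) : value π i = π ⟨i, h⟩ :=
  dif_pos h

/-- The probability that a random permutation of `k` elements has the pattern `Q`. -/
noncomputable def patternDensity (k : ℕ) (Q : (ℕ → ℕ) → Prop) [DecidablePred Q] : ℝ :=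
  (Finset.univ.filter fun σ : Equiv.Perm (Fin k) => Q (value σ)).card / (k.factorial : ℝ)

theorem patternDensity_turnPattern : patternDensity 3 TurnPattern = 2 / 3 := by
  have hcard :
      (Finset.univ.filter fun σ : Equiv.Perm (Fin 3) => TurnPattern (value σ)).card = 4 := by
    decide +kernel
  norm_num [patternDensity, hcard, Nat.factorial]

theorem patternDensity_monotonePattern : patternDensity 5 MonotonePattern = 1 / 60 := by
  have hcard :
      (Finset.univ.filter fun σ : Equiv.Perm (Fin 5) => MonotonePattern (value σ)).card = 2 := by
    decide +kernel
  norm_num [patternDensity, hcard, Nat.factorial]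

theorem patternDensity_interiorTurnPattern : patternDensity 6 InteriorTurnPattern = 1 / 30 := by
  have hcard : (Finset.univ.filter fun σ : Equiv.Perm (Fin 6) =>
      InteriorTurnPattern (value σ)).card = 24 := by
    decide +kernel
  norm_num [patternDensity, hcard, Nat.factorial]

end Patterns

section UpperBound

/-- The positions at most `3` to the right of an element of `T`. -/
def shadow (T : Finset ℕ) : Finset ℕ := T.biUnion fun e => Finset.Ioc e (e + 3)

variable {T U : Finset ℕ} {z : ℕ}

theorem mem_shadow : z ∈ shadow T ↔ ∃ e ∈ T, e < z ∧ z ≤ e + 3 := by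
  simp only [shadow, Finset.mem_biUnion, Finset.mem_Ioc]

theorem three_mul_card_filter_le {x t : ℕ} (ht : t ∉ shadow T)
    (hT : ∀ e ∈ T, x < e → e < t → e ∉ shadow T) :
    3 * (T.filter fun e => x ≤ e ∧ e < t).card ≤
      ((shadow T).filter fun z => x < z ∧ z < t).card := by
  have hdisj : Set.PairwiseDisjoint (T.filter fun e => x ≤ e ∧ e < t : Finset ℕ)
      fun e => Finset.Ioc e (e + 3) := by
    suffices h : ∀ e ∈ T, x ≤ e → ∀ e' ∈ T, e' < t → e < e' → e + 3 < e' by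
      intro e he e' he' hne
      rw [Finset.mem_coe, Finset.mem_filter] at he he'
      refine Finset.disjoint_left.2 fun z hz hz' => ?_
      simp only [Finset.mem_Ioc] at hz hz'
      rcases hne.lt_or_gt with hlt | hlt
      · have := h e he.1 he.2.1 e' he'.1 he'.2.2 hlt
        omega
      · have := h e' he'.1 he'.2.1 e he.1 he.2.2 hlt
        omega
    intro e he hxe e' he' he't hlt
    exact lt_of_not_ge fun hle =>
      hT e' he' (hxe.trans_lt hlt) he't (mem_shadow.2 ⟨e, he, hlt, hle⟩)
  calc 3 * (T.filter fun e => x ≤ e ∧ e < t).card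
      = ((T.filter fun e => x ≤ e ∧ e < t).biUnion fun e => Finset.Ioc e (e + 3)).card := by
        rw [Finset.card_biUnion hdisj]
        simp [mul_comm]
    _ ≤ ((shadow T).filter fun z => x < z ∧ z < t).card := by
        refine Finset.card_le_card fun z hz => ?_
        simp only [Finset.mem_biUnion, Finset.mem_filter, Finset.mem_Ioc] at hz
        obtain ⟨e, ⟨he, hxe, het⟩, hez, hze⟩ := hz
        refine Finset.mem_filter.2 ⟨mem_shadow.2 ⟨e, he, hez, hze⟩, hxe.trans_lt hez, ?_⟩
        exact lt_of_not_ge fun htz => ht (mem_shadow.2 ⟨e, he, het, htz.trans hze⟩)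

theorem exists_card_filter_le_card_shadow (h0 : 0 ∈ T)
    (hUT : ∀ x ∈ T, ∀ t, x < t → (U.filter fun z => x ≤ z ∧ z ≤ t).card ≤
      2 * (T.filter fun e => x ≤ e ∧ e < t).card + 2) (t : ℕ) :
    ∃ x ≤ t, (U.filter fun z => x ≤ z ∧ z ≤ t).card ≤
      ((shadow T).filter fun z => x ≤ z ∧ z ≤ t).card + if x = 0 then 1 else 0 := by
  have hU_single : (U.filter fun z => t ≤ z ∧ z ≤ t).card ≤ 1 :=
    Finset.card_le_one.2 fun a ha b hb => by
      rw [le_antisymm (Finset.mem_filter.1 ha).2.2 (Finset.mem_filter.1 ha).2.1,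
        le_antisymm (Finset.mem_filter.1 hb).2.2 (Finset.mem_filter.1 hb).2.1]
  by_cases ht : t ∈ shadow T
  · have hpos : 0 < ((shadow T).filter fun z => t ≤ z ∧ z ≤ t).card :=
      Finset.card_pos.2 ⟨t, by simp [ht]⟩
    exact ⟨t, le_rfl, by omega⟩
  rcases t.eq_zero_or_pos with rfl | ht0
  · exact ⟨0, le_rfl, by simpa using hU_single.trans (Nat.le_add_left _ _)⟩
  -- From the last `x ∈ T` on that is `0` or shadowed, the elements of `T` have disjoint shadows.
  set F := T.filter fun e => e < t ∧ (e = 0 ∨ e ∈ shadow T)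
  have hF : F.Nonempty := ⟨0, by simp [F, h0, ht0]⟩
  obtain ⟨x, hxF, hmax⟩ := F.exists_max_image id hF
  obtain ⟨hxT, hxt, hx⟩ := Finset.mem_filter.1 hxF
  have hU := hUT x hxT t hxt
  have hV := three_mul_card_filter_le (x := x) ht fun e he hxe het hes =>
    (hmax e (Finset.mem_filter.2 ⟨he, het, Or.inr hes⟩)).not_gt hxe
  have hpos : 0 < (T.filter fun e => x ≤ e ∧ e < t).card :=
    Finset.card_pos.2 ⟨x, by simp [hxT, hxt]⟩
  refine ⟨x, hxt.le, ?_⟩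
  split_ifs with hx0
  · have hmono := Finset.card_le_card <| Finset.monotone_filter_right (shadow T)
      fun z _ (hz : x < z ∧ z < t) => (⟨hz.1.le, hz.2.le⟩ : x ≤ z ∧ z ≤ t)
    omega
  · have hssub : (shadow T).filter (fun z => x < z ∧ z < t) ⊂
        (shadow T).filter fun z => x ≤ z ∧ z ≤ t :=
      (Finset.ssubset_iff_of_subset <| Finset.monotone_filter_right _ fun z _ hz =>
        ⟨hz.1.le, hz.2.le⟩).2 ⟨x, by simp [hx.resolve_left hx0, hxt.le], by simp⟩
    have := Finset.card_lt_card hssub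
    omega

theorem card_filter_lt_le_card_shadow (h0 : 0 ∈ T)
    (hUT : ∀ x ∈ T, ∀ t, x < t → (U.filter fun z => x ≤ z ∧ z ≤ t).card ≤
      2 * (T.filter fun e => x ≤ e ∧ e < t).card + 2) (t : ℕ) :
    (U.filter (· < t)).card ≤ ((shadow T).filter (· < t)).card + 1 := by
  induction t using Nat.strong_induction_on with
  | _ t ih =>
  rcases t with _ | t
  · simp
  obtain ⟨x, hxt, hx⟩ := exists_card_filter_le_card_shadow h0 hUT t
  have hsplit : ∀ V : Finset ℕ, (V.filter (· < t + 1)).card =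
      (V.filter (· < x)).card + (V.filter fun z => x ≤ z ∧ z ≤ t).card := fun V => by
    simp only [← Nat.lt_succ_iff (n := t)]
    exact card_filter_lt_eq_add V (hxt.trans t.le_succ)
  have hlt := ih x (Nat.lt_succ_of_le hxt)
  rw [hsplit, hsplit]
  split_ifs at hx with hx0
  · subst hx0
    simp only [Nat.not_lt_zero, Finset.filter_false, Finset.card_empty]
    omega
  · omega

theorem patternCount_add_card_shadow_le (g : ℕ → ℕ) (n : ℕ) :
    patternCount 5 MonotonePattern g 0 n +
      ((shadow (insert 0 (turns g (Finset.range n)))).filter (· < n)).card ≤ n := by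
  set V := (shadow (insert 0 (turns g (Finset.range n)))).filter (· < n)
  set W := (Finset.Ico 0 (n + 1 - 5)).filter fun i => MonotonePattern fun j => g (i + j)
  have hdisj : Disjoint (W.image (· + 4)) V := by
    refine Finset.disjoint_left.2 fun z hzW hzV => ?_
    obtain ⟨i, hi, rfl⟩ := Finset.mem_image.1 hzW
    have hmono : MonotonePattern fun j => g (i + j) := (Finset.mem_filter.1 hi).2
    obtain ⟨e, he, hei, hie⟩ := mem_shadow.1 (Finset.mem_filter.1 hzV).1
    have he' : e ∈ turns g (Finset.range n) := Finset.mem_of_mem_insert_of_ne he (by omega)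
    obtain ⟨l, rfl⟩ := Nat.exists_eq_add_of_lt (show i < e by omega)
    exact hmono l (by omega) (isTurn_range_succ.1 (mem_turns.1 he')).2
  have hsub : W.image (· + 4) ∪ V ⊆ Finset.range n := by
    refine Finset.union_subset (fun z hz => ?_) fun z hz =>
      Finset.mem_range.2 (Finset.mem_filter.1 hz).2
    obtain ⟨i, hi, rfl⟩ := Finset.mem_image.1 hz
    have := Finset.mem_Ico.1 (Finset.mem_filter.1 hi).1
    exact Finset.mem_range.2 (by omega)
  have hcard := Finset.card_le_card hsub
  rwa [Finset.card_union_of_disjoint hdisj, Finset.card_range,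
    Finset.card_image_of_injective W (add_left_injective 4)] at hcard

theorem two_mul_add_patternCount_le {g a b : ℕ → ℕ} {n w : ℕ}
    (ha : IsAlternatingAlong g (Finset.range n) a w)
    (hb : IsAlternatingAlong g (Finset.range n) b w) (hab : ∀ k < w, ∀ l < w, a k ≠ b l) :
    2 * w + patternCount 5 MonotonePattern g 0 n ≤ n + 1 := by
  set E := turns g (Finset.range n)
  set A := (Finset.range w).image a
  set B := (Finset.range w).image b
  have hdisj : Disjoint A B := by
    refine Finset.disjoint_left.2 fun z hzA hzB => ?_
    obtain ⟨k, hk, rfl⟩ := Finset.mem_image.1 hzA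
    obtain ⟨l, hl, hkl⟩ := Finset.mem_image.1 hzB
    exact hab k (Finset.mem_range.1 hk) l (Finset.mem_range.1 hl) hkl.symm
  have hcard : (A ∪ B).card = 2 * w := by
    rw [Finset.card_union_of_disjoint hdisj, ha.card_image, hb.card_image, two_mul]
  have hlt : ∀ z ∈ A ∪ B, z < n := fun z hz => by
    rcases Finset.mem_union.1 hz with hz | hz <;> obtain ⟨k, hk, rfl⟩ := Finset.mem_image.1 hz
    · exact Finset.mem_range.1 (ha.mem k (Finset.mem_range.1 hk))
    · exact Finset.mem_range.1 (hb.mem k (Finset.mem_range.1 hk))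
  have hshadow := card_filter_lt_le_card_shadow (Finset.mem_insert_self 0 E)
    (fun x hx t hxt => ha.card_union_filter_le hb (Finset.subset_insert 0 E) hx hxt) n
  rw [Finset.filter_true_of_mem hlt, hcard] at hshadow
  have := (Nat.add_le_add_left hshadow _).trans
    (Nat.add_le_add_right (patternCount_add_card_shadow_le g n) 1)
  omega

end UpperBound

section LowerBound

/-- The elements of `A` below `h` together with the elements of `B` from `h` on. -/
def splice (h : ℕ) (A B : Finset ℕ) : Finset ℕ := A.filter (· < h) ∪ B.filter (h ≤ ·)

variable {A B S : Finset ℕ} {g : ℕ → ℕ} {n h a i x y z : ℕ}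

theorem mem_splice_of_lt (hz : z < h) : z ∈ splice h A B ↔ z ∈ A := by
  simp [splice, hz, hz.not_ge]

theorem mem_splice_of_le (hz : h ≤ z) : z ∈ splice h A B ↔ z ∈ B := by
  simp [splice, hz, hz.not_gt]

theorem disjoint_splice (hAB : Disjoint A B) : Disjoint (splice h A B) (splice h B A) := by
  refine Finset.disjoint_left.2 fun z hz hz' => ?_
  rcases lt_or_ge z h with hlt | hle
  · rw [mem_splice_of_lt hlt] at hz hz'
    exact Finset.disjoint_left.1 hAB hz hz'
  · rw [mem_splice_of_le hle] at hz hz'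
    exact Finset.disjoint_left.1 hAB hz' hz

theorem splice_subset (hA : A ⊆ S) (hB : B ⊆ S) : splice h A B ⊆ S :=
  Finset.union_subset ((Finset.filter_subset _ _).trans hA) ((Finset.filter_subset _ _).trans hB)

theorem consecutive_add_one (ha : a ∈ S) (ha1 : a + 1 ∈ S) : Consecutive S a (a + 1) :=
  ⟨ha, ha1, a.lt_succ_self, fun _ _ hx => hx⟩

theorem consecutive_add_two (ha : a ∈ S) (ha1 : a + 1 ∉ S) (ha2 : a + 2 ∈ S) :
    Consecutive S a (a + 2) :=
  ⟨ha, ha2, by omega, fun x hx hax =>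
    Nat.succ_le_of_lt (lt_of_le_of_ne hax fun hax1 => ha1 (hax1 ▸ hx))⟩

/-- The interior positions of the sequence `g 0, …, g (n - 1)` which are not turns. -/
noncomputable def nonturns (g : ℕ → ℕ) (n : ℕ) : Finset ℕ :=
  Finset.Ioo 0 (n - 1) \ turns g (Finset.range n)

theorem succ_mem_nonturns : i + 1 ∈ nonturns g n ↔ i + 2 < n ∧ ¬TurnsAt g i := by
  rw [nonturns, Finset.mem_sdiff, Finset.mem_Ioo, mem_turns, isTurn_range_succ]
  constructor
  · rintro ⟨hi, hne⟩
    exact ⟨by omega, fun hturn => hne ⟨by omega, hturn⟩⟩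
  · rintro ⟨hi, hne⟩
    exact ⟨by omega, fun hturn => hne hturn.2⟩

theorem nonturns_subset (g : ℕ → ℕ) (n : ℕ) : nonturns g n ⊆ Finset.range n := fun z hz => by
  have := Finset.mem_Ioo.1 (Finset.mem_sdiff.1 hz).1
  exact Finset.mem_range.2 (by omega)

theorem patternCount_turnPattern_le
    (hS : ∀ z, x ≤ z → z < y → (z ∈ S ↔ z ∈ turns g (Finset.range n))) (hy : y ≤ n) :
    patternCount 3 TurnPattern g x y ≤
      ((turns g S).filter fun z => x ≤ z ∧ z < y).card + 2 := by
  refine LE.le.trans ?_ (card_turns_filter_le hS)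
  refine Finset.card_le_card_of_injOn (· + 1) (fun i hi => ?_) (add_left_injective 1).injOn
  obtain ⟨hi, hturn⟩ := Finset.mem_filter.1 hi
  obtain ⟨hxi, hiy⟩ := Finset.mem_Ico.1 hi
  rw [Finset.mem_coe, Finset.mem_filter, mem_turns, isTurn_range_succ]
  exact ⟨⟨by omega, hturn⟩, Nat.le_succ_of_le hxi, (by omega : i + 1 < y)⟩

theorem isTurn_of_earlyTurnPattern (hS : ∀ z, x ≤ z → z < y → (z ∈ S ↔ z ∈ nonturns g n))
    (hy : y ≤ n) (hx : x ≤ i) (hiy : i + 6 ≤ y) (h : EarlyTurnPattern fun j => g (i + j)) :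
    IsTurn g S (i + 2) := by
  obtain ⟨h1, h2, h3, h4, hdir⟩ := h
  have hmem : ∀ j ≤ 3, i + j + 1 ∈ S ↔ ¬TurnsAt g (i + j) := fun j hj => by
    rw [hS _ (by omega) (by omega), succ_mem_nonturns, and_iff_right (by omega)]
  have h1S := (hmem 0 (by omega)).2 h1
  have h2S := (hmem 1 (by omega)).2 h2
  have h3S := fun hS3 => (hmem 2 (by omega)).1 hS3 h3
  have h4S := (hmem 3 (by omega)).2 h4
  exact ⟨i + 1, i + 4, consecutive_add_one h1S h2S, consecutive_add_two h2S h3S h4S, hdir⟩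

theorem isTurn_of_lateTurnPattern (hS : ∀ z, x ≤ z → z < y → (z ∈ S ↔ z ∈ nonturns g n))
    (hy : y ≤ n) (hx : x ≤ i) (hiy : i + 6 ≤ y) (h : LateTurnPattern fun j => g (i + j)) :
    IsTurn g S (i + 3) := by
  obtain ⟨h1, h2, h3, h4, hdir⟩ := h
  have hmem : ∀ j ≤ 3, i + j + 1 ∈ S ↔ ¬TurnsAt g (i + j) := fun j hj => by
    rw [hS _ (by omega) (by omega), succ_mem_nonturns, and_iff_right (by omega)]
  have h1S := (hmem 0 (by omega)).2 h1
  have h2S := fun hS2 => (hmem 1 (by omega)).1 hS2 h2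
  have h3S := (hmem 2 (by omega)).2 h3
  have h4S := (hmem 3 (by omega)).2 h4
  exact ⟨i + 1, i + 4, consecutive_add_two h1S h2S h3S, consecutive_add_one h3S h4S, hdir⟩

theorem EarlyTurnPattern.not_lateTurnPattern (h : EarlyTurnPattern fun j => g (i + 1 + j)) :
    ¬LateTurnPattern fun j => g (i + j) := by
  obtain ⟨-, -, hturn, -⟩ := h
  rintro ⟨-, -, -, hnot, -⟩
  exact hnot (by simpa only [TurnsAt, add_assoc, Nat.reduceAdd] using hturn)

theorem patternCount_interiorTurnPattern_le
    (hS : ∀ z, x ≤ z → z < y → (z ∈ S ↔ z ∈ nonturns g n)) (hy : y ≤ n) :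
    patternCount 6 InteriorTurnPattern g x y ≤
      ((turns g S).filter fun z => x ≤ z ∧ z < y).card := by
  refine Finset.card_le_card_of_injOn
    (fun i => if EarlyTurnPattern (fun j => g (i + j)) then i + 2 else i + 3)
    (fun i hi => ?_) fun i hi i' hi' heq => ?_
  · obtain ⟨hi, hpattern⟩ := Finset.mem_filter.1 hi
    obtain ⟨hxi, hiy⟩ := Finset.mem_Ico.1 hi
    rw [Finset.mem_coe, Finset.mem_filter, mem_turns]
    dsimp only
    split_ifs with hearly
    · exact ⟨isTurn_of_earlyTurnPattern hS hy hxi (by omega) hearly, by omega, by omega⟩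
    · exact ⟨isTurn_of_lateTurnPattern hS hy hxi (by omega) (hpattern.resolve_left hearly),
        by omega, by omega⟩
  · have hpattern := (Finset.mem_filter.1 hi).2
    have hpattern' := (Finset.mem_filter.1 hi').2
    dsimp only at heq
    split_ifs at heq with hearly hearly' hearly'
    · omega
    · obtain rfl : i = i' + 1 := by omega
      exact (hearly.not_lateTurnPattern (hpattern'.resolve_left hearly')).elim
    · obtain rfl : i' = i + 1 := by omega
      exact (hearly'.not_lateTurnPattern (hpattern.resolve_left hearly)).elim
    · omega

theorem le_card_turns_splice_turns_nonturns (hh : h ≤ n) :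
    patternCount 3 TurnPattern g 0 h + patternCount 6 InteriorTurnPattern g h n ≤
      (turns g (splice h (turns g (Finset.range n)) (nonturns g n))).card + 2 := by
  set S := splice h (turns g (Finset.range n)) (nonturns g n)
  have hturn := patternCount_turnPattern_le (S := S) (x := 0) (g := g)
    (fun z _ hz => mem_splice_of_lt hz) hh
  have hinterior := patternCount_interiorTurnPattern_le (S := S) (x := h) (g := g)
    (fun z hz _ => mem_splice_of_le hz) le_rfl
  have := card_filter_add_card_filter_le (turns g S) 0 h n
  omega

theorem le_card_turns_splice_nonturns_turns (hh : h ≤ n) :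
    patternCount 6 InteriorTurnPattern g 0 h + patternCount 3 TurnPattern g h n ≤
      (turns g (splice h (nonturns g n) (turns g (Finset.range n)))).card + 2 := by
  set S := splice h (nonturns g n) (turns g (Finset.range n))
  have hturn := patternCount_turnPattern_le (S := S) (x := h) (g := g)
    (fun z hz _ => mem_splice_of_le hz) le_rfl
  have hinterior := patternCount_interiorTurnPattern_le (S := S) (x := 0) (g := g)
    (fun z _ hz => mem_splice_of_lt hz) hh
  have := card_filter_add_card_filter_le (turns g S) 0 h n
  omega

theorem exists_isAlternatingAlong {α : Type*} [LinearOrder α] {f : ℕ → α} {w : ℕ}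
    (hw : w < (turns f S).card) :
    ∃ u, IsAlternatingAlong f S u w ∧ (1 < w → f (u 0) < f (u 1)) := by
  set T := turns f S
  have hfin : (Set.ofPred (· ∈ T)).Finite := T.finite_toSet
  have hcard : hfin.toFinset.card = T.card := by congr 1; ext; simp
  set v := Nat.nth (· ∈ T)
  have hmem : ∀ k ≤ w, v k ∈ T := fun k hk =>
    Nat.nth_mem_of_lt_card hfin (by omega)
  have hmono : ∀ k l, k < l → l ≤ w → v k < v l := fun k l hkl hl =>
    Nat.nth_strictMonoOn hfin (Set.mem_Iio.2 (by omega)) (Set.mem_Iio.2 (by omega)) hkl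
  have hconsec : ∀ k < w, Consecutive T (v k) (v (k + 1)) := fun k hk =>
    ⟨hmem k hk.le, hmem (k + 1) hk, hmono k (k + 1) k.lt_succ_self hk, fun x hx hkx =>
      le_of_not_gt fun hxk => (Nat.le_nth_of_lt_nth_succ hxk hx).not_gt hkx⟩
  have halt : ∀ k, k + 2 ≤ w → TurnsAt (f ∘ v) k := fun k hk =>
    (hconsec k (by omega)).not_lt_iff_lt_of_turns (hconsec (k + 1) hk)
  by_cases hup : 1 < w → f (v 0) < f (v 1)
  · exact ⟨v, ⟨fun k _ l hl hkl => hmono k l hkl (le_of_lt hl),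
      fun k hk => turns_subset f S (hmem k hk.le), fun k hk => halt k hk.le⟩, hup⟩
  · obtain ⟨hw1, hdown⟩ := Classical.not_imp.1 hup
    refine ⟨fun k => v (k + 1), ⟨fun k _ l hl hkl => hmono _ _ (Nat.succ_lt_succ hkl) hl,
      fun k hk => turns_subset f S (hmem _ hk), fun k hk => halt (k + 1) hk⟩, fun _ => ?_⟩
    have hturn : ¬(f (v 0) < f (v 1) ↔ f (v 1) < f (v 2)) := halt 0 hw1
    tauto

end LowerBound

section Alpha

variable {n w h : ℕ}

theorem exists_orderEmbedding_shape_eq_altPlus (π : Equiv.Perm (Fin n)) {S : Finset ℕ} {u : ℕ → ℕ}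
    (hS : S ⊆ Finset.range n) (hu : IsAlternatingAlong (value π) S u w)
    (hup : 1 < w → value π (u 0) < value π (u 1)) :
    ∃ i : Fin w ↪o Fin n, (∀ k, (i k : ℕ) ∈ S) ∧ shape (π ∘ i) = altPlus w := by
  have hlt : ∀ k < w, u k < n := fun k hk => Finset.mem_range.1 (hS (hu.mem k hk))
  refine ⟨OrderEmbedding.ofStrictMono (fun k => ⟨u k, hlt k k.2⟩) fun k l hkl => hu.lt hkl l.2,
    fun k => hu.mem k k.2, funext fun k => ?_⟩
  have hk : (k : ℕ) + 1 < w := by omega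
  have hstep : value π (u k) < value π (u (k + 1)) ↔ Even (k : ℕ) :=
    (hu.isAlternating.lt_iff_even hk).trans (iff_true_right (hup (by omega)))
  rw [value_of_lt π (hlt k (by omega)), value_of_lt π (hlt (k + 1) hk)] at hstep
  exact decide_eq_decide.2 hstep

theorem le_alpha_of_lt_card_turns (π : Equiv.Perm (Fin n)) {S T : Finset ℕ}
    (hS : S ⊆ Finset.range n) (hT : T ⊆ Finset.range n) (hST : Disjoint S T)
    (hwS : w < (turns (value π) S).card) (hwT : w < (turns (value π) T).card) : w ≤ alpha π := by
  obtain ⟨u, hu, huup⟩ := exists_isAlternatingAlong hwS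
  obtain ⟨v, hv, hvup⟩ := exists_isAlternatingAlong hwT
  obtain ⟨i, hiS, hi⟩ := exists_orderEmbedding_shape_eq_altPlus π hS hu huup
  obtain ⟨j, hjT, hj⟩ := exists_orderEmbedding_shape_eq_altPlus π hT hv hvup
  refine (isGreatest_alpha π).2 ⟨i, j, ⟨Set.disjoint_left.2 ?_, hi.trans hj.symm⟩, Or.inl hi⟩
  rintro _ ⟨k, rfl⟩ ⟨l, hl⟩
  exact Finset.disjoint_left.1 hST (hiS k) (hl ▸ hjT l)

theorem le_alpha_add_three_of_le_patternCount (π : Equiv.Perm (Fin n)) (hh : h ≤ n) {m : ℕ}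
    (hm : m ≤ patternCount 3 TurnPattern (value π) 0 h +
      patternCount 6 InteriorTurnPattern (value π) h n)
    (hm' : m ≤ patternCount 6 InteriorTurnPattern (value π) 0 h +
      patternCount 3 TurnPattern (value π) h n) :
    m ≤ alpha π + 3 := by
  have hE := turns_subset (value π) (Finset.range n)
  have hN := nonturns_subset (value π) n
  have hS := hm.trans (le_card_turns_splice_turns_nonturns hh)
  have hT := hm'.trans (le_card_turns_splice_nonturns_turns hh)
  rcases le_or_gt m 3 with hm3 | hm3
  · omega
  have hle : m - 3 ≤ alpha π :=
    le_alpha_of_lt_card_turns (S := splice h _ _) (T := splice h _ _) π (splice_subset hE hN)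
      (splice_subset hN hE) (disjoint_splice Finset.disjoint_sdiff) (by omega) (by omega)
  omega

/-- The position sequence of `i`, continued by zeros. -/
def positions (i : Fin w ↪o Fin n) (k : ℕ) : ℕ := if h : k < w then i ⟨k, h⟩ else 0

theorem positions_of_lt (i : Fin w ↪o Fin n) {k : ℕ} (hk : k < w) :
    positions i k = i ⟨k, hk⟩ :=
  dif_pos hk

theorem value_positions (π : Equiv.Perm (Fin n)) (i : Fin w ↪o Fin n) {k : ℕ} (hk : k < w) :
    value π (positions i k) = π (i ⟨k, hk⟩) := by
  rw [positions_of_lt i hk, value_of_lt π (i ⟨k, hk⟩).2]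

theorem isAlternatingAlong_positions (π : Equiv.Perm (Fin n)) (i : Fin w ↪o Fin n)
    (hi : shape (π ∘ i) = altPlus w ∨ shape (π ∘ i) = altMinus w) :
    IsAlternatingAlong (value π) (Finset.range n) (positions i) w where
  strictMonoOn k hk l hl hkl := by
    rw [positions_of_lt i hk, positions_of_lt i hl]
    exact i.strictMono hkl
  mem k hk := by
    rw [positions_of_lt i hk]
    exact Finset.mem_range.2 (i ⟨k, hk⟩).2
  isAlternating k hk := by
    have hval : ∀ l (hl : l + 1 < w), (value π (positions i l) < value π (positions i (l + 1)) ↔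
        shape (π ∘ i) ⟨l, by omega⟩ = true) := fun l hl => by
      rw [value_positions π i (by omega), value_positions π i hl]
      simp [shape]
    simp only [TurnsAt, Function.comp_apply]
    rw [hval k (by omega), hval (k + 1) hk]
    rcases hi with hi | hi <;>
      simp [hi, altPlus, altMinus, ← Nat.not_even_iff_odd, Nat.even_add_one]

theorem two_mul_alpha_add_patternCount_le (π : Equiv.Perm (Fin n)) :
    2 * alpha π + patternCount 5 MonotonePattern (value π) 0 n ≤ n + 1 := by
  obtain ⟨i, j, ⟨hdisj, hshape⟩, hi⟩ := (isGreatest_alpha π).1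
  refine two_mul_add_patternCount_le (isAlternatingAlong_positions π i hi)
    (isAlternatingAlong_positions π j (hshape ▸ hi)) fun k hk l hl heq => ?_
  rw [positions_of_lt i hk, positions_of_lt j hl] at heq
  exact Set.disjoint_left.1 hdisj ⟨_, rfl⟩ ⟨_, (Fin.ext heq).symm⟩

end Alpha

section SecondMoment

theorem sum_mul_eq_zero_of_sum_translate_eq_zero {R G K : Type*} [Ring R] [NoZeroDivisors R]
    [CharZero R] [Group G] [Fintype G] [Fintype K] [Nonempty K] {φ : K → G} {X Y : G → R}
    (hX : ∀ g, ∑ σ, X (g * φ σ) = 0) (hY : ∀ g σ, Y (g * φ σ) = Y g) : ∑ g, X g * Y g = 0 := by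
  have htranslate (σ : K) : ∑ g, X g * Y g = ∑ g, X (g * φ σ) * Y g := by
    rw [← Equiv.sum_comp (Equiv.mulRight (φ σ))]
    simp only [Equiv.coe_mulRight, hY]
  have haverage : ∑ _σ : K, ∑ g, X g * Y g = 0 := by
    rw [Finset.sum_congr rfl fun σ _ => htranslate σ, Finset.sum_comm]
    simp only [← Finset.sum_mul, hX, zero_mul, Finset.sum_const_zero]
  simpa using haverage

theorem sum_sq_sum_le_of_sum_mul_eq_zero {Ω : Type*} [Fintype Ω] {X : ℕ → Ω → ℝ} {I : Finset ℕ}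
    {k : ℕ} (hX : ∀ i ∈ I, ∀ ω, |X i ω| ≤ 1)
    (horth : ∀ i ∈ I, ∀ j ∈ I, i + k ≤ j → ∑ ω, X i ω * X j ω = 0) :
    ∑ ω, (∑ i ∈ I, X i ω) ^ 2 ≤ I.card * (2 * k) * Fintype.card Ω := by
  have hpair : ∀ i ∈ I, ∀ j ∈ I, ∑ ω, X i ω * X j ω ≤
      if j ∈ Finset.Ico (i - k) (i + k) then (Fintype.card Ω : ℝ) else 0 := by
    intro i hi j hj
    split_ifs with hij
    · calc ∑ ω, X i ω * X j ω ≤ ∑ _ω : Ω, (1 : ℝ) := by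
            refine Finset.sum_le_sum fun ω _ => (le_abs_self _).trans ?_
            rw [abs_mul]
            exact mul_le_one₀ (hX i hi ω) (abs_nonneg _) (hX j hj ω)
        _ = Fintype.card Ω := by simp
    · rw [Finset.mem_Ico] at hij
      rcases le_total i j with hle | hle
      · exact (horth i hi j hj (by omega)).le
      · simp only [mul_comm (X i _)]
        exact (horth j hj i hi (by omega)).le
  have hnear (i : ℕ) : (I.filter (· ∈ Finset.Ico (i - k) (i + k))).card ≤ 2 * k := by
    refine (Finset.card_le_card fun j hj => (Finset.mem_filter.1 hj).2).trans ?_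
    rw [Nat.card_Ico]
    omega
  calc ∑ ω, (∑ i ∈ I, X i ω) ^ 2 = ∑ i ∈ I, ∑ j ∈ I, ∑ ω, X i ω * X j ω := by
        simp_rw [sq, Finset.sum_mul_sum]
        rw [Finset.sum_comm]
        exact Finset.sum_congr rfl fun i _ => Finset.sum_comm
    _ ≤ ∑ i ∈ I, ∑ j ∈ I,
          if j ∈ Finset.Ico (i - k) (i + k) then (Fintype.card Ω : ℝ) else 0 :=
        Finset.sum_le_sum fun i hi => Finset.sum_le_sum (hpair i hi)
    _ ≤ ∑ _i ∈ I, (2 * k : ℝ) * Fintype.card Ω := by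
        refine Finset.sum_le_sum fun i _ => ?_
        rw [← Finset.sum_filter, Finset.sum_const, nsmul_eq_mul]
        gcongr
        exact_mod_cast hnear i
    _ = I.card * (2 * k) * Fintype.card Ω := by
        rw [Finset.sum_const, nsmul_eq_mul, ← mul_assoc]

theorem toOuterMeasure_uniformOfFintype_le_abs {Ω : Type*} [Fintype Ω] [Nonempty Ω] (Z : Ω → ℝ)
    {η : ℝ} (hη : 0 < η) :
    (PMF.uniformOfFintype Ω).toOuterMeasure {ω | η ≤ |Z ω|} ≤
      ENNReal.ofReal ((∑ ω, Z ω ^ 2) / (Fintype.card Ω * η ^ 2)) := by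
  classical
  have hΩ : (0 : ℝ) < Fintype.card Ω := by exact_mod_cast Fintype.card_pos
  have hmarkov : ((Finset.univ.filter fun ω => η ≤ |Z ω|).card : ℝ) * η ^ 2 ≤ ∑ ω, Z ω ^ 2 := by
    rw [← nsmul_eq_mul]
    refine (Finset.card_nsmul_le_sum _ (fun ω => Z ω ^ 2) _ fun ω hω => ?_).trans
      (Finset.sum_le_univ_sum_of_nonneg fun ω => sq_nonneg _)
    exact sq_le_sq.2 (by simpa [abs_of_pos hη] using (Finset.mem_filter.1 hω).2)
  rw [PMF.toOuterMeasure_uniformOfFintype_apply, ← Set.toFinset_card, Set.toFinset_ofPred,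
    ← ENNReal.ofReal_natCast, ← ENNReal.ofReal_natCast (Fintype.card Ω),
    ← ENNReal.ofReal_div_of_pos hΩ]
  refine ENNReal.ofReal_le_ofReal ?_
  rw [div_le_div_iff₀ hΩ (by positivity)]
  nlinarith

end SecondMoment

section AsymptoticallyAlmostSurely

open Filter Topology

theorem toOuterMeasure_compl {Ω : Type*} (p : PMF Ω) (s : Set Ω) :
    p.toOuterMeasure sᶜ = 1 - p.toOuterMeasure s := by
  let _ : MeasurableSpace Ω := ⊤
  rw [← p.toMeasure_apply_eq_toOuterMeasure, ← p.toMeasure_apply_eq_toOuterMeasure,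
    MeasureTheory.prob_compl_eq_one_sub MeasurableSpace.measurableSet_top]

theorem toOuterMeasure_le_one {Ω : Type*} (p : PMF Ω) (s : Set Ω) : p.toOuterMeasure s ≤ 1 := by
  let _ : MeasurableSpace Ω := ⊤
  rw [← p.toMeasure_apply_eq_toOuterMeasure]
  exact MeasureTheory.prob_le_one

variable {Ω : ℕ → Type*} {p : ∀ n, PMF (Ω n)} {s t : ∀ n, Set (Ω n)}

/-- The events `s n` hold asymptotically almost surely for the distributions `p n`. -/
def HoldsAAS (p : ∀ n, PMF (Ω n)) (s : ∀ n, Set (Ω n)) : Prop :=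
  Tendsto (fun n => (p n).toOuterMeasure (s n)) atTop (𝓝 1)

theorem holdsAAS_iff_tendsto_compl :
    HoldsAAS p s ↔ Tendsto (fun n => (p n).toOuterMeasure (s n)ᶜ) atTop (𝓝 0) := by
  constructor <;> intro h
  · simpa only [toOuterMeasure_compl, tsub_self] using
      ENNReal.Tendsto.sub tendsto_const_nhds h (Or.inl ENNReal.one_ne_top)
  · have h' := ENNReal.Tendsto.sub (tendsto_const_nhds (x := (1 : ENNReal))) h
      (Or.inl ENNReal.one_ne_top)
    simpa only [HoldsAAS, ← toOuterMeasure_compl, compl_compl, tsub_zero] using h'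

theorem HoldsAAS.mono (hs : HoldsAAS p s) (hst : ∀ᶠ n in atTop, s n ⊆ t n) : HoldsAAS p t :=
  tendsto_of_tendsto_of_tendsto_of_le_of_le' hs tendsto_const_nhds
    (hst.mono fun n h => (p n).toOuterMeasure.mono h)
    (Eventually.of_forall fun n => toOuterMeasure_le_one (p n) (t n))

theorem HoldsAAS.inter (hs : HoldsAAS p s) (ht : HoldsAAS p t) :
    HoldsAAS p fun n => s n ∩ t n := by
  rw [holdsAAS_iff_tendsto_compl] at hs ht ⊢
  refine tendsto_of_tendsto_of_tendsto_of_le_of_le tendsto_const_nhds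
    (by simpa only [add_zero] using hs.add ht) (fun n => zero_le) fun n => ?_
  rw [Set.compl_inter]
  exact MeasureTheory.measure_union_le _ _

end AsymptoticallyAlmostSurely

section Concentration

open Filter Topology

variable {n k i j : ℕ} {Q : (ℕ → ℕ) → Prop} [DecidablePred Q]

theorem value_injOn (π : Equiv.Perm (Fin n)) : Set.InjOn (value π) (Set.Iio n) := by
  intro i hi j hj h
  rw [value_of_lt π hi, value_of_lt π hj] at h
  exact congrArg Fin.val (π.injective (Fin.ext h))

theorem card_filter_value_comp_eq (hQ : DependsOnOrder k Q) {x : Fin k → ℕ}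
    (hx : Function.Injective x) (y : Equiv.Perm (Fin k) → ℕ → ℕ)
    (hy : ∀ σ (j : Fin k), y σ j = x (σ j)) :
    (Finset.univ.filter fun σ => Q (y σ)).card =
      (Finset.univ.filter fun σ : Equiv.Perm (Fin k) => Q (value σ)).card := by
  have hsort : StrictMono (x ∘ Tuple.sort x) :=
    (Tuple.monotone_sort x).strictMono_of_injective (hx.comp (Tuple.sort x).injective)
  refine Finset.card_equiv (Equiv.mulLeft (Tuple.sort x)⁻¹) fun σ => ?_
  simp only [Finset.mem_filter, Finset.mem_univ, true_and]
  refine hQ _ _ fun i hi j hj => ?_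
  have hiff := hsort.lt_iff_lt (a := (Tuple.sort x)⁻¹ (σ ⟨i, hi⟩))
    (b := (Tuple.sort x)⁻¹ (σ ⟨j, hj⟩))
  simpa [hy σ ⟨i, hi⟩, hy σ ⟨j, hj⟩, value_of_lt _ hi, value_of_lt _ hj] using hiff

/-- The window of positions `i, …, i + k - 1`. -/
def window (k i : ℕ) (h : i + k ≤ n) : Fin k ↪ Fin n where
  toFun j := ⟨i + j, by omega⟩
  inj' a b hab := by
    ext
    simpa using hab

theorem value_mul_viaEmbedding (h : i + k ≤ n) (π : Equiv.Perm (Fin n)) (σ : Equiv.Perm (Fin k))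
    (j : Fin k) : value (π * σ.viaEmbedding (window k i h)) (i + j) = value π (i + σ j) := by
  rw [value_of_lt _ (by omega), value_of_lt _ (by omega), Equiv.Perm.mul_apply]
  exact congrArg (fun a => (π a : ℕ)) (σ.viaEmbedding_apply (window k i h) j)

theorem value_mul_viaEmbedding_of_notMem (h : i + k ≤ n) (π : Equiv.Perm (Fin n))
    (σ : Equiv.Perm (Fin k)) (hj : j < i ∨ i + k ≤ j) :
    value (π * σ.viaEmbedding (window k i h)) j = value π j := by
  by_cases hn : j < n
  · rw [value_of_lt _ hn, value_of_lt _ hn, Equiv.Perm.mul_apply,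
      Equiv.Perm.viaEmbedding_apply_of_notMem]
    rintro ⟨l, hl⟩
    have : i + l = j := congrArg Fin.val hl
    omega
  · simp [value, hn]

theorem patternDensity_mem_Icc (k : ℕ) (Q : (ℕ → ℕ) → Prop) [DecidablePred Q] :
    patternDensity k Q ∈ Set.Icc 0 1 := by
  refine ⟨by unfold patternDensity; positivity, ?_⟩
  rw [patternDensity, div_le_one (by positivity)]
  have hle := Finset.card_filter_le (Finset.univ : Finset (Equiv.Perm (Fin k)))
    fun σ => Q (value σ)
  rw [Finset.card_univ, Fintype.card_perm, Fintype.card_fin] at hle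
  exact_mod_cast hle

/-- The centered indicator of the event that `π` has the pattern `Q` in the window of length `k`
at `i`. -/
noncomputable def centered (k : ℕ) (Q : (ℕ → ℕ) → Prop) [DecidablePred Q] (i : ℕ)
    (π : Equiv.Perm (Fin n)) : ℝ :=
  (if Q fun j => value π (i + j) then 1 else 0) - patternDensity k Q

theorem abs_centered_le_one (π : Equiv.Perm (Fin n)) : |centered k Q i π| ≤ 1 := by
  obtain ⟨h0, h1⟩ := patternDensity_mem_Icc k Q
  rw [abs_le, centered]
  split_ifs <;> constructor <;> linarith

/-- The difference between the number of windows in `[x, y)` where `π` has the pattern `Q` and its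
expectation. -/
noncomputable def deviation (k : ℕ) (Q : (ℕ → ℕ) → Prop) [DecidablePred Q] (x y : ℕ)
    (π : Equiv.Perm (Fin n)) : ℝ :=
  patternCount k Q (value π) x y - patternDensity k Q * (y + 1 - k - x : ℕ)

theorem deviation_eq_sum_centered (π : Equiv.Perm (Fin n)) (x y : ℕ) :
    deviation k Q x y π = ∑ i ∈ Finset.Ico x (y + 1 - k), centered k Q i π := by
  simp only [deviation, centered, Finset.sum_sub_distrib, Finset.sum_boole, patternCount,
    Finset.sum_const, nsmul_eq_mul, Nat.card_Ico]
  ring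

theorem sum_centered_mul_viaEmbedding (hQ : DependsOnOrder k Q) (h : i + k ≤ n)
    (π : Equiv.Perm (Fin n)) :
    ∑ σ : Equiv.Perm (Fin k), centered k Q i (π * σ.viaEmbedding (window k i h)) = 0 := by
  have hinj : Function.Injective fun j : Fin k => value π (i + j) := fun a b hab => by
    have := value_injOn π (show i + (a : ℕ) < n by omega) (show i + (b : ℕ) < n by omega) hab
    omega
  have hcard := card_filter_value_comp_eq hQ hinj
    (fun σ j => value (π * σ.viaEmbedding (window k i h)) (i + j))
    fun σ j => value_mul_viaEmbedding h π σ j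
  have hk : (k.factorial : ℝ) ≠ 0 := by positivity
  simp only [centered, Finset.sum_sub_distrib, Finset.sum_const, Finset.card_univ,
    Fintype.card_perm, Fintype.card_fin, nsmul_eq_mul, patternDensity, Finset.sum_boole, hcard]
  rw [mul_div_cancel₀ _ hk, sub_self]

theorem sum_centered_mul_centered (hQ : DependsOnOrder k Q) (hij : i + k ≤ j) (h : i + k ≤ n) :
    ∑ π : Equiv.Perm (Fin n), centered k Q i π * centered k Q j π = 0 :=
  sum_mul_eq_zero_of_sum_translate_eq_zero (sum_centered_mul_viaEmbedding hQ h) fun π σ => by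
    have hsame (l : ℕ) : value (π * σ.viaEmbedding (window k i h)) (j + l) = value π (j + l) :=
      value_mul_viaEmbedding_of_notMem h π σ (by omega)
    simp only [centered, hsame]

theorem toOuterMeasure_le_abs_deviation_le (hQ : DependsOnOrder k Q) {x y : ℕ}
    (hy : y ≤ n) {η : ℝ} (hη : 0 < η) :
    (PMF.uniformOfFintype (Equiv.Perm (Fin n))).toOuterMeasure
        {π | η ≤ |deviation k Q x y π|} ≤ ENNReal.ofReal (2 * k * (n / η ^ 2)) := by
  simp only [deviation_eq_sum_centered]
  refine (toOuterMeasure_uniformOfFintype_le_abs _ hη).trans (ENNReal.ofReal_le_ofReal ?_)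
  have hsecond := sum_sq_sum_le_of_sum_mul_eq_zero (Ω := Equiv.Perm (Fin n))
    (X := centered k Q) (I := Finset.Ico x (y + 1 - k)) (k := k)
    (fun i _ π => abs_centered_le_one π) fun i hi j _ hij =>
      sum_centered_mul_centered hQ hij (by rw [Finset.mem_Ico] at hi; omega)
  have hwindows : (Finset.Ico x (y + 1 - k)).card * (2 * k) ≤ 2 * k * n := by
    rcases k.eq_zero_or_pos with rfl | hk
    · simp
    · rw [mul_comm, Nat.card_Ico]
      exact Nat.mul_le_mul_left _ (by omega)
  have hΩ : (0 : ℝ) < Fintype.card (Equiv.Perm (Fin n)) := by exact_mod_cast Fintype.card_pos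
  rw [div_le_iff₀ (by positivity)]
  refine hsecond.trans ?_
  calc ((Finset.Ico x (y + 1 - k)).card * (2 * k) : ℝ) * Fintype.card (Equiv.Perm (Fin n))
      ≤ (2 * k * n : ℝ) * Fintype.card (Equiv.Perm (Fin n)) := by
        refine mul_le_mul_of_nonneg_right ?_ hΩ.le
        exact_mod_cast hwindows
    _ = _ := by field_simp

theorem holdsAAS_abs_deviation_lt (hQ : DependsOnOrder k Q) (x : ℕ → ℕ) {y : ℕ → ℕ}
    (hy : ∀ n, y n ≤ n) {η : ℕ → ℝ} (hη : ∀ᶠ n in atTop, 0 < η n)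
    (hlim : Tendsto (fun n : ℕ => n / η n ^ 2) atTop (𝓝 0)) :
    HoldsAAS (fun n => PMF.uniformOfFintype (Equiv.Perm (Fin n))) fun n =>
      {π | |deviation k Q (x n) (y n) π| < η n} := by
  rw [holdsAAS_iff_tendsto_compl]
  have hbound : Tendsto (fun n : ℕ => ENNReal.ofReal (2 * k * (n / η n ^ 2))) atTop (𝓝 0) := by
    simpa only [mul_zero, ENNReal.ofReal_zero] using
      ENNReal.tendsto_ofReal (hlim.const_mul (2 * k : ℝ))
  refine tendsto_of_tendsto_of_tendsto_of_le_of_le' tendsto_const_nhds hbound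
    (Eventually.of_forall fun n => zero_le) ?_
  filter_upwards [hη] with n hn
  simpa only [Set.compl_ofPred, not_lt] using
    toOuterMeasure_le_abs_deviation_le hQ (hy n) hn

end Concentration

section Asymptotics

open Filter Topology

theorem le_alpha_and_alpha_le_of_abs_deviation_lt {n : ℕ} {η : ℝ} {π : Equiv.Perm (Fin n)}
    (hT : |deviation 3 TurnPattern 0 (n / 2) π| < η)
    (hT' : |deviation 3 TurnPattern (n / 2) n π| < η)
    (hI : |deviation 6 InteriorTurnPattern 0 (n / 2) π| < η)
    (hI' : |deviation 6 InteriorTurnPattern (n / 2) n π| < η)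
    (hM : |deviation 5 MonotonePattern 0 n π| < η) :
    (1 / 3 + 1 / 60) * (n : ℝ) - (5 + 2 * η) ≤ alpha π ∧
      alpha π ≤ (1 / 2 - 1 / 120) * (n : ℝ) + (5 + 2 * η) := by
  simp only [deviation, patternDensity_turnPattern, patternDensity_interiorTurnPattern,
    patternDensity_monotonePattern, abs_lt] at hT hT' hI hI' hM
  have hT_windows : (n : ℝ) ≤ 2 * (n / 2 + 1 - 3 - 0 : ℕ) + 5 := by norm_cast; omega
  have hT_windows' : (n : ℝ) ≤ 2 * (n + 1 - 3 - n / 2 : ℕ) + 4 := by norm_cast; omega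
  have hI_windows : (n : ℝ) ≤ 2 * (n / 2 + 1 - 6 - 0 : ℕ) + 11 := by norm_cast; omega
  have hI_windows' : (n : ℝ) ≤ 2 * (n + 1 - 6 - n / 2 : ℕ) + 10 := by norm_cast; omega
  have hM_windows : (n : ℝ) ≤ (n + 1 - 5 - 0 : ℕ) + 4 := by norm_cast; omega
  constructor
  · have hlower := le_alpha_add_three_of_le_patternCount π (Nat.div_le_self n 2)
      (min_le_left _ _) (min_le_right _ _)
    rcases min_le_iff.1 hlower with hlower | hlower <;>
    · replace hlower := Nat.cast_le (α := ℝ).2 hlower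
      push_cast at hlower
      linarith
  · have hupper := Nat.cast_le (α := ℝ).2 (two_mul_alpha_add_patternCount_le π)
    push_cast at hupper
    linarith

theorem holdsAAS_le_alpha_and_alpha_le {η : ℕ → ℝ} (hη : ∀ᶠ n in atTop, 0 < η n)
    (hlim : Tendsto (fun n : ℕ => n / η n ^ 2) atTop (𝓝 0)) :
    HoldsAAS (fun n => PMF.uniformOfFintype (Equiv.Perm (Fin n))) fun n =>
      {π | (1 / 3 + 1 / 60) * (n : ℝ) - (5 + 2 * η n) ≤ alpha π ∧
        alpha π ≤ (1 / 2 - 1 / 120) * (n : ℝ) + (5 + 2 * η n)} := by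
  have hhalf (n : ℕ) : n / 2 ≤ n := n.div_le_self 2
  have hT := holdsAAS_abs_deviation_lt dependsOnOrder_turnPattern 0 hhalf hη hlim
  have hT' := holdsAAS_abs_deviation_lt dependsOnOrder_turnPattern (· / 2) (fun _ => le_rfl) hη hlim
  have hI := holdsAAS_abs_deviation_lt dependsOnOrder_interiorTurnPattern 0 hhalf hη hlim
  have hI' := holdsAAS_abs_deviation_lt dependsOnOrder_interiorTurnPattern (· / 2)
    (fun _ => le_rfl) hη hlim
  have hM := holdsAAS_abs_deviation_lt dependsOnOrder_monotonePattern 0 (fun _ => le_rfl) hη hlim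
  refine ((((hT.inter hT').inter hI).inter hI').inter hM).mono (Eventually.of_forall fun n => ?_)
  rintro π ⟨⟨⟨⟨hT, hT'⟩, hI⟩, hI'⟩, hM⟩
  exact le_alpha_and_alpha_le_of_abs_deviation_lt hT hT' hI hI' hM

theorem tendsto_natCast_rpow_neg {s : ℝ} (hs : 0 < s) :
    Tendsto (fun n : ℕ => (n : ℝ) ^ (-s)) atTop (𝓝 0) :=
  (tendsto_rpow_neg_atTop hs).comp tendsto_natCast_atTop_atTop

theorem tendsto_natCast_div_rpow_three_quarters_sq :
    Tendsto (fun n : ℕ => n / ((n : ℝ) ^ (3 / 4 : ℝ)) ^ 2) atTop (𝓝 0) := by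
  refine (tendsto_natCast_rpow_neg (one_half_pos (α := ℝ))).congr' ?_
  filter_upwards [eventually_gt_atTop 0] with n hn
  have hn' : (0 : ℝ) < n := by exact_mod_cast hn
  rw [← Real.rpow_natCast, ← Real.rpow_mul hn'.le]
  nth_rewrite 2 [← Real.rpow_one (n : ℝ)]
  rw [← Real.rpow_sub hn']
  norm_num

theorem tendsto_add_mul_rpow_three_quarters_div (a b : ℝ) :
    Tendsto (fun n : ℕ => (a + b * (n : ℝ) ^ (3 / 4 : ℝ)) / n) atTop (𝓝 0) := by
  have hlim := (tendsto_const_div_atTop_nhds_zero_nat a).add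
    ((tendsto_natCast_rpow_neg (show (0 : ℝ) < 1 / 4 by norm_num)).const_mul b)
  rw [mul_zero, add_zero] at hlim
  refine hlim.congr' ?_
  filter_upwards [eventually_gt_atTop 0] with n hn
  have hn' : (0 : ℝ) < n := by exact_mod_cast hn
  rw [show (-(1 / 4) : ℝ) = 3 / 4 - 1 by norm_num, Real.rpow_sub_one hn'.ne']
  ring

end Asymptotics

end Twins

theorem theorem2 :
    ∃ ε δ : ℕ → ℝ,
      Filter.Tendsto ε Filter.atTop (nhds 0) ∧ Filter.Tendsto δ Filter.atTop (nhds 0) ∧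
      Filter.Tendsto
        (fun n : ℕ => (PMF.uniformOfFintype (Equiv.Perm (Fin n))).toOuterMeasure
          {π | ((1 : ℝ) / 3 + 1 / 60 + ε n) * (n : ℝ) ≤ (Twins.alpha π : ℝ) ∧
            (Twins.alpha π : ℝ) ≤ ((1 : ℝ) / 2 - 1 / 120 + δ n) * (n : ℝ)})
        Filter.atTop (nhds 1) := by
  have herror := Twins.tendsto_add_mul_rpow_three_quarters_div 5 2
  have hpos : ∀ᶠ n : ℕ in Filter.atTop, (0 : ℝ) < (n : ℝ) ^ (3 / 4 : ℝ) := by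
    filter_upwards [Filter.eventually_gt_atTop 0] with n hn
    positivity
  have hbounds := Twins.holdsAAS_le_alpha_and_alpha_le hpos
    Twins.tendsto_natCast_div_rpow_three_quarters_sq
  refine ⟨_, _, by simpa only [neg_zero] using herror.neg, herror, hbounds.mono ?_⟩
  filter_upwards [Filter.eventually_gt_atTop 0] with n hn π ⟨hlower, hupper⟩
  have hn' : (n : ℝ) ≠ 0 := by exact_mod_cast hn.ne'
  refine ⟨?_, ?_⟩
  · rwa [add_mul, neg_mul, div_mul_cancel₀ _ hn', ← sub_eq_add_neg]
  · rwa [add_mul, div_mul_cancel₀ _ hn']
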